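/- Let $H$ be a finite connected graph with vertices $v_1,\dots,v_m$, multiple edges allowed but no loops; let $a_{i,j}$ be the number of edges between $v_i$ and $v_j$, and $d_i=\sum_j a_{i,j}$. For each $i$ let $1\le s_{i,1}<s_{i,2}<\dots<s_{i,k_i}$ be integers ($k_i=0$ is allowed), and assume that the greatest common divisor of all the jumps $s_{i,p}$ ($1\le i\le m$, $1\le p\le k_i$) is $1$. For $n\ge 1$ let $H_n$ be the circulant foliation over $H$ with fibres $G_i=C_n(s_{i,1},\dots,s_{i,k_i})$: its vertices are the pairs $(k,v_i)$ with $k\in\mathbb{Z}/n$; for every $k$ the vertices $(k,v_i)$ and $(k,v_j)$, $i\ne j$, are joined by $a_{i,j}$ edges; and for every $i$, $p$ and $k$ there is one edge joining $(k,v_i)$ and $(k+s_{i,p},v_i)$ (so that there are two edges between $(k,v_i)$ and $(k+\frac n2,v_i)$ if $s_{i,p}=\frac n2$). Let $\tau(n)$ be the number of spanning trees of $H_n$. For $x=(x_1,\dots,x_m)$ let $L(H,x)$ be the $m\times m$ matrix with diagonal entries $x_i$ and off-diagonal entries $-a_{i,j}$, and put $$P(z)=\det L(H,x)\ \text{ with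 }\ x_i=2k_i+d_i-\sum_{p=1}^{k_i}\bigl(z^{s_{i,p}}+z^{-s_{i,p}}\bigr),\qquad Q(w)=\det L(H,x)\ \text{ with }\ x_i=2k_i+d_i-\sum_{p=1}^{k_i}2T_{s_{i,p}}(w),$$ where $T_s$ is the Chebyshev polynomial of the first kind. Let $q=\sum_{i=1}^m\sum_{p=1}^{k_i}s_{i,p}^2$. Then the integral $\int_0^1\log|Q(\cos 2\pi t)|\,dt$ converges, $A=\exp\int_0^1\log|Q(\cos 2\pi t)|\,dt$ is the Mahler measure of the Laurent polynomial $P(z)$ (that is, of the polynomial $z^NP(z)$ for every $N\geq 0$ for which this is a polynomial), and $$\tau(n)\sim\frac{n}{q}A^n,\qquad n\to\infty.$$ -/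

import Mathlib

open scoped Graph

namespace CirculantFoliation

noncomputable section

/-- The number of spanning trees of a multigraph `G`: the number of sets `F` of edges of `G` such
that the subgraph formed by all vertices of `G` and the edges in `F` has neither loops nor parallel
edges and is, as a simple graph, a tree. Parallel edges of `G` are counted as different edges. -/
def numSpanningTrees {V E : Type*} (G : Graph V E) : ℕ :=
  {F : Set E | F ⊆ E(G) ∧ (G.restrict F).Simple ∧ (G.restrict F).toSimpleGraph.IsTree}.ncard

/-- `mult H u v` is the number of edges of the multigraph `H` between `u` and `v`. -/
def mult {V E : Type*} (H : Graph V E) (u v : V) : ℕ :=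
  {e : E | H.IsLink e u v}.ncard

/-- The degree of `u`, as the sum of the entries of its row in the adjacency matrix. -/
def deg {V E : Type*} [Fintype V] (H : Graph V E) (u : V) : ℕ :=
  ∑ v, mult H u v

/-- The generalized Laplacian matrix `L(H, X) = X(H) - A(H)`, where `X(H)` is the diagonal matrix
with entries `x u` and `A(H)` is the adjacency matrix of `H`. -/
def genLaplacian {V E R : Type*} [DecidableEq V] [CommRing R] (H : Graph V E) (x : V → R) :
    Matrix V V R :=
  Matrix.diagonal x - Matrix.of fun u v => (mult H u v : R)

/-- The circulant foliation `H_n` over `H` in which the fibre over the vertex `u` is the circulant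
graph on `n` vertices with set of jumps `S u`. Its vertices are the pairs `(k, u)` with `k` in
`ℤ/n` and `u` a vertex of `H`. Each `k` and each edge `e` of `H` give the edge `Sum.inl (k, e)`,
which joins `(k, u)` and `(k, v)` if `e` joins `u` and `v`; each `k`, each vertex `u` and
each jump `s ∈ S u` give the edge `Sum.inr (k, u, s)`, which joins `(k, u)` and `(k + s, u)`. -/
def foliation {V E : Type*} (H : Graph V E) (S : V → Finset ℕ) (n : ℕ) :
    Graph (ZMod n × V) ((ZMod n × E) ⊕ (ZMod n × V × ℕ)) where
  vertexSet := {x | x.2 ∈ V(H)}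
  IsLink e x y :=
    match e with
    | Sum.inl (k, e) => x.1 = k ∧ y.1 = k ∧ H.IsLink e x.2 y.2
    | Sum.inr (k, u, s) => u ∈ V(H) ∧ s ∈ S u ∧ s((k, u), (k + (s : ZMod n), u)) = s(x, y)
  isLink_symm := by
    rintro (⟨k, e⟩ | ⟨k, u, s⟩) - <;> constructor <;> rintro x y h
    · exact ⟨h.2.1, h.1, h.2.2.symm⟩
    · exact ⟨h.1, h.2.1, h.2.2.trans Sym2.eq_swap⟩
  eq_or_eq_of_isLink_of_isLink := by
    rintro (⟨k, e⟩ | ⟨k, u, s⟩) x y v w h h'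
    · rcases h.2.2.left_eq_or_eq h'.2.2 with h1 | h1
      · exact Or.inl (Prod.ext (h.1.trans h'.1.symm) h1)
      · exact Or.inr (Prod.ext (h.1.trans h'.2.1.symm) h1)
    · have h1 : x ∈ s(v, w) := by
        rw [← h'.2.2, h.2.2]; exact Sym2.mem_mk_left x y
      exact Sym2.mem_iff.1 h1
  left_mem_of_isLink := by
    rintro (⟨k, e⟩ | ⟨k, u, s⟩) x y h
    · exact h.2.2.left_mem
    · have h1 : x ∈ s((k, u), (k + (s : ZMod n), u)) := by
        rw [h.2.2]; exact Sym2.mem_mk_left x y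
      rcases Sym2.mem_iff.1 h1 with rfl | rfl
      · exact h.1
      · exact h.1

open LaurentPolynomial in
/-- The Laurent polynomial `P(z) = det L(H, X)`, where
`x u = 2 k_u + d_u - ∑ s ∈ S u, (z ^ s + z ^ (-s))` and `k_u` is the number of jumps at `u`. -/
def P {V E : Type*} [Fintype V] [DecidableEq V] (H : Graph V E) (S : V → Finset ℕ) :
    LaurentPolynomial ℂ :=
  (genLaplacian H fun u =>
    ((2 * (S u).card + deg H u : ℕ) : LaurentPolynomial ℂ) -
      ∑ s ∈ S u, (T (s : ℤ) + T (-(s : ℤ)))).det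

/-- The Chebyshev transform `Q(w) = det L(H, W)` of `P`, where
`w u = 2 k_u + d_u - ∑ s ∈ S u, 2 T_s(w)` with the Chebyshev polynomials of the first kind. -/
def Q {V E : Type*} [Fintype V] [DecidableEq V] (H : Graph V E) (S : V → Finset ℕ) :
    Polynomial ℝ :=
  (genLaplacian H fun u =>
    ((2 * (S u).card + deg H u : ℕ) : Polynomial ℝ) -
      ∑ s ∈ S u, 2 * Polynomial.Chebyshev.T ℝ (s : ℤ)).det

/-- The constant `A = exp (∫₀¹ log |Q(cos 2πt)| dt)`. -/
def A {V E : Type*} [Fintype V] [DecidableEq V] (H : Graph V E) (S : V → Finset ℕ) : ℝ :=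
  Real.exp (∫ t in (0 : ℝ)..1, Real.log |(Q H S).eval (Real.cos (2 * Real.pi * t))|)

/-- The sum `q` of the squares of all jumps. -/
def q {V : Type*} [Fintype V] (S : V → Finset ℕ) : ℕ :=
  ∑ u, ∑ s ∈ S u, s ^ 2

end

end CirculantFoliation

/-! Let `B` be the oriented incidence matrix of `H_n` with an extra column of ones. Then `B * Bᵀ` is
the Laplacian plus the all-ones matrix, and Cauchy–Binet gives `det (B * Bᵀ) = (n m)² τ(n)`
(`det_augIncidence_mul_transpose`). The Fourier transform over `ℤ/n` splits this matrix into `n`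
blocks of size `m` (`fourier_intertwining`). The block at `j ≠ 0` has determinant `P(ζ^j)`, where `ζ
= exp(2πi/n)`; the block at `0` has determinant `n m · c m`, where `c ≠ 0` is the common cofactor of
the Laplacian of `H`. Hence `n τ(n) = c ∏_{j≠0} P(ζ^j)`.

Adding all rows of the matrix of `P` to one row exhibits a double zero at `1`: `z^N P(z) = (z-1)²
r(z)` with `r(1) = -c q` (`exists_toLaurent_eq`). Since `∏_{j≠0} |ζ^j - 1| = n`, the constant `c`
cancels and `τ(n) = (n/q) ∏_j |r(ζ^j)|`, the product now running over all `j`.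

For `|z| = 1`, `z ≠ 1`, the gcd condition makes the matrix of `P(z)` a connected Laplacian plus a
nonzero, nonnegative diagonal, hence nonsingular (`symbol_ne_zero`). So `r` has no zero on the unit
circle, and `∏_j |r(ζ^j)| = |lead r|^n ∏_α |α^n - 1|`, over the roots `α` of `r`, is asymptotic to
`M(r)^n`. Finally `M(r) = M(P) = A`, because `M(z - 1) = 1`. -/

namespace CirculantFoliation

open Matrix Finset

/-! ### Cauchy–Binet and the matrix tree theorem for index sets of edges -/

/-- A symmetrised form of the Cauchy–Binet formula for `B * Bᵀ`. -/
theorem factorial_mul_det_mul_transpose {n α R : Type*} [Fintype n] [DecidableEq n] [Fintype α]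
    [CommRing R] (B : Matrix n α R) :
    ((Fintype.card n).factorial : R) * (B * Bᵀ).det =
      ∑ f : n → α, (B.submatrix id f).det ^ 2 := by
  have h1 : (B * Bᵀ).det = ∑ f : n → α, (∏ i, B i (f i)) * (B.submatrix id f).det := by
    simp only [det_apply', mul_apply, transpose_apply, Finset.prod_univ_sum, Fintype.piFinset_univ,
      Finset.mul_sum, submatrix_apply, id]
    rw [Finset.sum_comm]
    refine Finset.sum_congr rfl fun f _ => Finset.sum_congr rfl fun σ _ => ?_
    rw [Finset.prod_mul_distrib]; ring
  -- Reindexing the sum over `f` by `σ` brings out its sign; averaging over all `σ` then turns the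
  -- product of entries into a second determinant.
  have h2 (σ : Equiv.Perm n) : (B * Bᵀ).det =
      ∑ f : n → α, (∏ i, B i (f (σ i))) * ((Equiv.Perm.sign σ : ℤ) : R) *
        (B.submatrix id f).det := by
    rw [h1, ← Equiv.sum_comp (σ.symm.arrowCongr (Equiv.refl α))]
    refine Finset.sum_congr rfl fun f _ => ?_
    have : B.submatrix id ((σ.symm.arrowCongr (Equiv.refl α)) f) =
        (B.submatrix id f).submatrix id σ := by
      ext; simp [Equiv.arrowCongr]
    rw [this, det_permute']
    simp [Equiv.arrowCongr, mul_assoc]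
  have h3 : ((Fintype.card n).factorial : R) * (B * Bᵀ).det =
      ∑ _σ : Equiv.Perm n, (B * Bᵀ).det := by
    simp [Fintype.card_perm]
  rw [h3, Finset.sum_congr rfl fun σ _ => h2 σ, Finset.sum_comm]
  refine Finset.sum_congr rfl fun f _ => ?_
  rw [← Finset.sum_mul, sq]
  congr 1
  rw [← det_transpose, det_apply']
  refine Finset.sum_congr rfl fun σ _ => ?_
  simp [mul_comm]

/-- A map onto a set of the same finite size is a bijection. This is the multiplicity that cancels
the factorial in the symmetrised Cauchy–Binet formula. -/
theorem card_filter_image_eq {n β : Type*} [Fintype n] [DecidableEq n] [Fintype β] [DecidableEq β]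
    (S : Finset β) (hS : S.card = Fintype.card n) :
    (univ.filter fun f : n → β => univ.image f = S).card = (Fintype.card n).factorial := by
  have e : n ≃ S := Fintype.equivOfCardEq (by simp [hS])
  rw [← Fintype.card_equiv e, ← Finset.card_univ]
  symm
  refine Finset.card_bij (fun g _ v => (g v : β)) ?_ ?_ ?_
  · intro g _
    simp only [mem_filter, mem_univ, true_and]
    ext x
    simp only [mem_image, mem_univ, true_and]
    constructor
    · rintro ⟨v, rfl⟩; exact (g v).2
    · intro hx; exact ⟨g.symm ⟨x, hx⟩, by simp⟩
  · intro g _ g' _ h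
    ext v; exact congrFun h v
  · intro f hf
    simp only [mem_filter, mem_univ, true_and] at hf
    have hm (v : n) : f v ∈ S := hf ▸ mem_image_of_mem f (mem_univ v)
    have hs : Function.Surjective (fun v => (⟨f v, hm v⟩ : S)) := by
      rintro ⟨x, hx⟩
      rw [← hf] at hx
      obtain ⟨v, -, rfl⟩ := mem_image.1 hx
      exact ⟨v, rfl⟩
    exact ⟨Equiv.ofBijective _ ((Fintype.bijective_iff_surjective_and_card _).2
      ⟨hs, by simp [hS]⟩), mem_univ _, by ext v; simp⟩

section Incidence

variable {V α : Type*} (a b : α → V)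

/-- The simple graph spanned by the edges in `F`. -/
def edgeGraph (F : Set α) : SimpleGraph V :=
  SimpleGraph.fromRel fun u v => ∃ e ∈ F, a e = u ∧ b e = v

theorem edgeGraph_reachable {F : Set α} {e : α} (he : e ∈ F) :
    (edgeGraph a b F).Reachable (a e) (b e) := by
  by_cases h : a e = b e
  · rw [h]
  · exact SimpleGraph.Adj.reachable (by
      simp only [edgeGraph, SimpleGraph.fromRel_adj]; exact ⟨h, Or.inl ⟨e, he, rfl, rfl⟩⟩)

theorem edgeGraph_reachable_induction {F : Set α} (p : V → Prop)
    (h : ∀ e ∈ F, p (a e) ↔ p (b e)) {u v : V}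
    (huv : (edgeGraph a b F).Reachable u v) (hu : p u) : p v := by
  obtain ⟨w⟩ := huv
  induction w with
  | nil => exact hu
  | cons hadj _ ih =>
    apply ih
    simp only [edgeGraph, SimpleGraph.fromRel_adj] at hadj
    rcases hadj with ⟨-, ⟨e, he, rfl, rfl⟩ | ⟨e, he, rfl, rfl⟩⟩
    · exact (h e he).1 hu
    · exact (h e he).2 hu

variable [DecidableEq V]

/-- The oriented incidence matrix with an additional column of ones. -/
def augIncidence : Matrix V (Option α) ℤ :=
  Matrix.of fun v o => o.elim 1 fun e => (if v = b e then 1 else 0) - (if v = a e then 1 else 0)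

variable [Fintype V]

theorem sum_augIncidence_some (e : α) : ∑ v, augIncidence a b v (some e) = 0 := by
  simp [augIncidence]

theorem det_augIncidence_eq_zero_of_forall_ne_none [Nonempty V] (f : V → Option α)
    (hf : ∀ v, f v ≠ none) : ((augIncidence a b).submatrix id f).det = 0 := by
  rw [← Matrix.exists_vecMul_eq_zero_iff]
  refine ⟨fun _ => 1, fun h => one_ne_zero (congrFun h (Classical.arbitrary V)), ?_⟩
  ext v
  obtain ⟨e, he⟩ := Option.ne_none_iff_exists'.1 (hf v)
  simp only [vecMul, dotProduct, submatrix_apply, id, one_mul, he, Pi.zero_apply]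
  exact sum_augIncidence_some a b e

theorem det_augIncidence_eq_zero_of_not_connected [Nonempty V] (f : V → Option α)
    (hf : ¬ (edgeGraph a b {e | some e ∈ Set.range f}).Connected) :
    ((augIncidence a b).submatrix id f).det = 0 := by
  classical
  set G := edgeGraph a b {e | some e ∈ Set.range f} with hG
  have : ¬ G.Preconnected := fun h => hf ⟨h⟩
  simp only [SimpleGraph.Preconnected, not_forall] at this
  obtain ⟨u, w, huw⟩ := this
  set C : Finset V := univ.filter fun v => G.Reachable u v with hC
  rw [← Matrix.exists_vecMul_eq_zero_iff]
  -- A left kernel vector: constant on components, so it kills the edge columns, and shifted to have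
  -- sum zero, so it kills the column of ones.
  refine ⟨fun v => (Fintype.card V : ℤ) * (if G.Reachable u v then 1 else 0) - C.card, ?_, ?_⟩
  · intro h
    have h1 := congrFun h w
    have h2 := congrFun h u
    simp only [huw, if_false, Pi.zero_apply, SimpleGraph.Reachable.refl, if_true] at h1 h2
    have : 0 < Fintype.card V := Fintype.card_pos
    omega
  · ext v
    simp only [vecMul, dotProduct, submatrix_apply, id, Pi.zero_apply]
    rcases hv : f v with _ | e
    · simp [augIncidence, Finset.sum_sub_distrib, hC]
      rw [← Finset.sum_filter]
      simp [mul_comm]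
    · have he : e ∈ {e | some e ∈ Set.range f} := ⟨v, hv⟩
      have hr : G.Reachable u (a e) ↔ G.Reachable u (b e) :=
        ⟨fun h => h.trans (edgeGraph_reachable a b he),
          fun h => h.trans (edgeGraph_reachable a b he).symm⟩
      simp [augIncidence, mul_sub, Finset.sum_sub_distrib, hr]

/-- Replace the column of ones by the unit vector at `r`. Edge columns are differences of unit
vectors, so moving along edges from `r` reaches every unit vector, and the new matrix `M'` is
unimodular. Restoring the column of ones multiplies the determinant by `|V|`. -/
theorem sq_det_augIncidence_of_connected (f : V → Option α) (hinj : Function.Injective f) (r : V)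
    (hr : f r = none) (hf : (edgeGraph a b {e | some e ∈ Set.range f}).Connected) :
    ((augIncidence a b).submatrix id f).det ^ 2 = (Fintype.card V : ℤ) ^ 2 := by
  set M := (augIncidence a b).submatrix id f with hM
  set M' := M.updateCol r (Pi.single r 1) with hM'
  have hsome (k : V) (hk : k ≠ r) : ∃ e, f k = some e :=
    Option.ne_none_iff_exists'.1 fun h => hk (hinj (h.trans hr.symm))
  have hcol (v : V) : ∑ u, M' u v = if v = r then 1 else 0 := by
    split_ifs with h
    · subst h; simp [hM', Pi.single_apply]
    · obtain ⟨e, he⟩ := hsome v h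
      simp [hM', updateCol_ne h, hM, he, sum_augIncidence_some]
  have hex (v : V) : ∃ y : V → ℤ, M' *ᵥ y = Pi.single v 1 := by
    refine edgeGraph_reachable_induction a b
      (fun v => ∃ y : V → ℤ, M' *ᵥ y = Pi.single v 1) ?_ (hf.preconnected r v) ?_
    · rintro e ⟨k, hk⟩
      have hkr : k ≠ r := by rintro rfl; simp [hr] at hk
      have hMk : M' *ᵥ Pi.single k 1 = Pi.single (b e) 1 - Pi.single (a e) 1 := by
        ext v
        simp [hM', updateCol_ne hkr, hM, hk, augIncidence, Pi.single_apply]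
      constructor
      · rintro ⟨y, hy⟩
        exact ⟨y + Pi.single k 1, by rw [mulVec_add, hy, hMk]; abel⟩
      · rintro ⟨y, hy⟩
        exact ⟨y - Pi.single k 1, by rw [mulVec_sub, hy, hMk]; abel⟩
    · exact ⟨Pi.single r 1, by ext v; simp [hM', Pi.single_apply]⟩
  choose y hy using hex
  -- Sum the rows of `M' *ᵥ y v`: only column `r` of `M'` has nonzero sum.
  have hyr (v : V) : y v r = 1 := by
    have h := congrArg (fun x : V → ℤ => ∑ u, x u) (hy v)
    simp only [mulVec, dotProduct] at h
    rw [Finset.sum_comm] at h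
    simpa [← Finset.sum_mul, hcol] using h
  have hdet' : M'.det ^ 2 = 1 := by
    have h : M' * (Matrix.of fun i v => y v i) = 1 := by
      ext i v
      have := congrFun (hy v) i
      simpa [mul_apply, mulVec, dotProduct, Matrix.one_apply, Pi.single_apply] using this
    have h2 : IsUnit M'.det := IsUnit.of_mul_eq_one _ (by rw [← det_mul, h, det_one])
    exact Int.isUnit_sq h2
  have hdet : M.det = Fintype.card V * M'.det := by
    have h := det_updateCol_sum M' r (∑ v, y v)
    have h1 : (M'.updateCol r fun k => ∑ i, (∑ v, y v) i • M' k i) = M := by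
      have h2 : (fun k => ∑ i, (∑ v, y v) i • M' k i) = fun _ => 1 := by
        have : M' *ᵥ (∑ v, y v) = fun _ => 1 := by
          rw [mulVec_sum, Finset.sum_congr rfl fun v _ => hy v]
          ext k; simp [Pi.single_apply]
        rw [← this]
        ext k; simp [mulVec, dotProduct, mul_comm]
      rw [h2, hM', updateCol_idem]
      ext i j
      by_cases hj : j = r
      · subst hj; simp [hM, hr, augIncidence]
      · simp [updateCol_ne hj]
    rw [h1] at h
    rw [h]
    simp [hyr]
  rw [hdet, mul_pow, hdet', mul_one]

/-- The matrix tree theorem, in terms of the determinant of the sum of the Laplacian and the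
all-ones matrix. -/
theorem det_augIncidence_mul_transpose [Nonempty V] [Fintype α]
    [DecidablePred fun F : Finset α => (edgeGraph a b (F : Set α)).Connected] :
    (augIncidence a b * (augIncidence a b)ᵀ).det = (Fintype.card V : ℤ) ^ 2 *
      (univ.filter fun F : Finset α =>
        F.card + 1 = Fintype.card V ∧ (edgeGraph a b (F : Set α)).Connected).card := by
  classical
  set 𝒯 := univ.filter fun F : Finset α =>
        F.card + 1 = Fintype.card V ∧ (edgeGraph a b (F : Set α)).Connected with h𝒯
  have hfac : ((Fintype.card V).factorial : ℤ) ≠ 0 := by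
    exact_mod_cast (Nat.factorial_pos _).ne'
  apply mul_left_cancel₀ hfac
  rw [factorial_mul_det_mul_transpose]
  -- A choice of columns survives only if it is injective, contains the column of ones and has a
  -- connected edge set; it then belongs to exactly one `F`.
  have key (f : V → Option α) : ((augIncidence a b).submatrix id f).det ^ 2 =
      ∑ F ∈ 𝒯, if univ.image f = F.insertNone then (Fintype.card V : ℤ) ^ 2 else 0 := by
    by_cases hF : ∃ F ∈ 𝒯, univ.image f = F.insertNone
    · obtain ⟨F, hF, hfF⟩ := hF
      rw [Finset.sum_eq_single_of_mem F hF]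
      · rw [if_pos hfF]
        simp only [h𝒯, mem_filter, mem_univ, true_and] at hF
        have hset : {e | some e ∈ Set.range f} = (F : Set α) := by
          ext e
          have : some e ∈ univ.image f ↔ some e ∈ F.insertNone := by rw [hfF]
          simpa using this
        have hn : none ∈ univ.image f := by rw [hfF]; simp
        obtain ⟨r, -, hr⟩ := mem_image.1 hn
        refine sq_det_augIncidence_of_connected a b f ?_ r hr (by rw [hset]; exact hF.2)
        rw [← Set.injOn_univ, ← Finset.coe_univ, ← Finset.card_image_iff, hfF,
          Finset.card_insertNone, hF.1, Finset.card_univ]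
      · intro F' _ hne
        rw [if_neg]
        rw [hfF]
        exact fun h => hne (Finset.insertNone.injective h.symm)
    · rw [Finset.sum_eq_zero fun F hF' => if_neg fun h => hF ⟨F, hF', h⟩]
      rw [sq_eq_zero_iff]
      by_cases hnone : ∃ r, f r = none
      · by_cases hinj : Function.Injective f
        · by_cases hc : (edgeGraph a b {e | some e ∈ Set.range f}).Connected
          · exfalso
            obtain ⟨r, hr⟩ := hnone
            have him : univ.image f = (univ.image f).eraseNone.insertNone := by
              ext o
              rcases o with _ | e
              · simpa using ⟨r, hr⟩
              · simp
            refine hF ⟨(univ.image f).eraseNone, ?_, him⟩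
            simp only [h𝒯, mem_filter, mem_univ, true_and]
            constructor
            · rw [← Finset.card_insertNone, ← him, Finset.card_image_of_injective _ hinj,
                Finset.card_univ]
            · convert hc using 2
              ext e; simp
          · exact det_augIncidence_eq_zero_of_not_connected a b f hc
        · obtain ⟨i, j, hij, hne⟩ := Function.not_injective_iff.1 hinj
          exact det_zero_of_column_eq hne fun k => by simp [hij]
      · push Not at hnone
        exact det_augIncidence_eq_zero_of_forall_ne_none a b f hnone
  rw [Finset.sum_congr rfl fun f _ => key f, Finset.sum_comm]
  have h4 (F : Finset α) (hF : F ∈ 𝒯) :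
      (∑ f : V → Option α, if univ.image f = F.insertNone then (Fintype.card V : ℤ) ^ 2 else 0) =
        (Fintype.card V).factorial * (Fintype.card V : ℤ) ^ 2 := by
    rw [← Finset.sum_filter, Finset.sum_const, card_filter_image_eq]
    · simp
    · simp only [h𝒯, mem_filter, mem_univ, true_and] at hF
      rw [Finset.card_insertNone, hF.1]
  rw [Finset.sum_congr rfl h4]
  simp
  ring

end Incidence

end CirculantFoliation

/-! ### Spanning trees of a multigraph as edge sets -/

namespace CirculantFoliation

open Matrix Finset

section SpanningTrees

variable {V α : Type*} {a b : α → V}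

theorem edgeGraph_adj {F : Set α} {u v : V} :
    (edgeGraph a b F).Adj u v ↔ u ≠ v ∧ ∃ e ∈ F, s(a e, b e) = s(u, v) := by
  simp only [edgeGraph, SimpleGraph.fromRel_adj, Sym2.eq_iff]
  refine and_congr_right fun _ => ?_
  constructor
  · rintro (⟨e, he, h⟩ | ⟨e, he, h⟩)
    · exact ⟨e, he, Or.inl h⟩
    · exact ⟨e, he, Or.inr ⟨h.1, h.2⟩⟩
  · rintro ⟨e, he, h | h⟩
    · exact Or.inl ⟨e, he, h⟩
    · exact Or.inr ⟨e, he, h.1, h.2⟩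

theorem edgeGraph_edgeSet {F : Set α} :
    (edgeGraph a b F).edgeSet = ((fun e => s(a e, b e)) '' F) \ Sym2.diagSet := by
  ext z
  induction z with
  | h u v =>
    simp [edgeGraph_adj, and_comm]

/-- A connected graph needs at least `|V| - 1` edges, so a connected `F` of exactly that size can
lose nothing to loops or parallel edges. -/
theorem edgeGraph_isTree_iff [Fintype V] (F : Finset α) :
    ((∀ e ∈ F, a e ≠ b e) ∧ Set.InjOn (fun e => s(a e, b e)) F ∧
        (edgeGraph a b (F : Set α)).IsTree) ↔
      F.card + 1 = Fintype.card V ∧ (edgeGraph a b (F : Set α)).Connected := by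
  classical
  have hfin : ((fun e => s(a e, b e)) '' (F : Set α)).Finite := F.finite_toSet.image _
  rw [SimpleGraph.isTree_iff_connected_and_card, Nat.card_eq_fintype_card (α := V),
    Nat.card_coe_set_eq]
  constructor
  · rintro ⟨hne, hinj, hc, hcard⟩
    refine ⟨?_, hc⟩
    rw [← hcard, edgeGraph_edgeSet, sdiff_eq_left.2, hinj.ncard_image,
      Set.ncard_coe_finset]
    rw [Set.disjoint_left]
    rintro _ ⟨e, he, rfl⟩
    simpa using hne e he
  · rintro ⟨hcard, hc⟩
    have h1 := hc.card_vert_le_card_edgeSet_add_one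
    rw [Nat.card_eq_fintype_card, Nat.card_coe_set_eq, edgeGraph_edgeSet] at h1
    have h2 := Set.ncard_le_ncard (s := ((fun e => s(a e, b e)) '' (F : Set α)) \ Sym2.diagSet)
      Set.sdiff_subset hfin
    have h3 := Set.ncard_image_le (f := fun e => s(a e, b e)) F.finite_toSet
    rw [Set.ncard_coe_finset] at h3
    have hinj : Set.InjOn (fun e => s(a e, b e)) (F : Set α) :=
      (Set.ncard_image_iff F.finite_toSet).1 (by rw [Set.ncard_coe_finset]; omega)
    have heq := Set.eq_of_subset_of_ncard_le
      (s := ((fun e => s(a e, b e)) '' (F : Set α)) \ Sym2.diagSet) Set.sdiff_subset (by omega) hfin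
    refine ⟨fun e he hab => ?_, hinj, hc, ?_⟩
    · have : s(a e, b e) ∈ ((fun e => s(a e, b e)) '' (F : Set α)) \ Sym2.diagSet := by
        rw [heq]; exact ⟨e, he, rfl⟩
      exact this.2 (by simp [hab])
    · rw [edgeGraph_edgeSet]; omega

variable {E : Type*} {G : Graph V E} {φ : α → E}

/-- The spanning subgraph with a given set of edges, formed in the index type or in the multigraph. -/
def edgeGraphIso (hV : V(G) = Set.univ)
    (hl : ∀ e, G.IsLink (φ e) (a e) (b e)) (F : Set α) :
    edgeGraph a b F ≃g (G.restrict (φ '' F)).toSimpleGraph where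
  toFun v := ⟨v, by rw [Graph.vertexSet_restrict, hV]; trivial⟩
  invFun v := v
  left_inv _ := rfl
  right_inv _ := rfl
  map_rel_iff' := by
    intro u v
    simp only [Equiv.coe_fn_mk, Graph.toSimpleGraph_adj, edgeGraph_adj, Graph.Adj,
      Graph.restrict_isLink, ne_eq, Subtype.mk.injEq]
    refine and_congr_right fun _ => ?_
    constructor
    · rintro ⟨_, ⟨e, he, rfl⟩, h⟩
      exact ⟨e, he, by rw [Sym2.eq_iff]; exact (hl e).eq_and_eq_or_eq_and_eq h⟩
    · rintro ⟨e, he, h⟩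
      refine ⟨φ e, ⟨e, he, rfl⟩, ?_⟩
      rcases Sym2.eq_iff.1 h with ⟨rfl, rfl⟩ | ⟨rfl, rfl⟩
      · exact hl e
      · exact (hl e).symm

theorem restrict_simple_iff (hφ : Function.Injective φ)
    (hl : ∀ e, G.IsLink (φ e) (a e) (b e)) (F : Set α) :
    (G.restrict (φ '' F)).Simple ↔
      (∀ e ∈ F, a e ≠ b e) ∧ Set.InjOn (fun e => s(a e, b e)) F := by
  constructor
  · intro h
    refine ⟨fun e he hab => ?_, fun e he e' he' hee => hφ ?_⟩
    · have : (G.restrict (φ '' F)).IsLink (φ e) (a e) (b e) := ⟨⟨e, he, rfl⟩, hl e⟩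
      exact this.ne hab
    · have h1 : (G.restrict (φ '' F)).IsLink (φ e) (a e) (b e) := ⟨⟨e, he, rfl⟩, hl e⟩
      have h2 : (G.restrict (φ '' F)).IsLink (φ e') (a e) (b e) := by
        refine ⟨⟨e', he', rfl⟩, ?_⟩
        rcases Sym2.eq_iff.1 hee with ⟨h, h'⟩ | ⟨h, h'⟩
        · rw [h, h']; exact hl e'
        · rw [h, h']; exact (hl e').symm
      exact h1.eq h2
  · rintro ⟨hne, hinj⟩
    refine { not_isLoopAt := ?_, eq_of_isLink := ?_ }
    · rintro _ x ⟨⟨e, he, rfl⟩, h⟩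
      rcases (hl e).eq_and_eq_or_eq_and_eq h with ⟨h1, h2⟩ | ⟨h1, h2⟩ <;>
        exact hne e he (h1.trans h2.symm)
    · rintro _ _ x y ⟨⟨e, he, rfl⟩, h⟩ ⟨⟨e', he', rfl⟩, h'⟩
      congr 1
      refine hinj he he' ?_
      have h1 := Sym2.eq_iff.2 ((hl e).eq_and_eq_or_eq_and_eq h)
      have h2 := Sym2.eq_iff.2 ((hl e').eq_and_eq_or_eq_and_eq h')
      exact h1.trans h2.symm

/-- The matrix tree theorem for multigraphs. -/
theorem card_sq_mul_numSpanningTrees [Fintype V] [DecidableEq V] [Nonempty V] [Fintype α]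
    (hV : V(G) = Set.univ) (hφ : Function.Injective φ) (hr : Set.range φ = E(G))
    (hl : ∀ e, G.IsLink (φ e) (a e) (b e)) :
    (Fintype.card V : ℤ) ^ 2 * numSpanningTrees G =
      (augIncidence a b * (augIncidence a b)ᵀ).det := by
  classical
  rw [det_augIncidence_mul_transpose, numSpanningTrees]
  congr 2
  rw [← Set.ncard_coe_finset, ← Set.ncard_image_of_injective _
    (hφ.image_injective.comp Finset.coe_injective)]
  congr 1
  ext F
  simp only [Set.mem_ofPred_eq, Set.mem_image, coe_filter, mem_univ, true_and, Function.comp_apply]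
  have key (F' : Finset α) : ((G.restrict (φ '' F')).Simple ∧
      (G.restrict (φ '' F')).toSimpleGraph.IsTree) ↔
      (F'.card + 1 = Fintype.card V ∧ (edgeGraph a b (F' : Set α)).Connected) := by
    rw [← edgeGraph_isTree_iff, restrict_simple_iff hφ hl, and_assoc,
      (edgeGraphIso hV hl _).isTree_iff]
    rfl
  constructor
  · rintro ⟨hF, h⟩
    rw [← hr] at hF
    obtain ⟨F', rfl⟩ := Set.subset_range_iff_exists_image_eq.1 hF
    obtain ⟨F', rfl⟩ := F'.toFinite.exists_finset_coe
    exact ⟨F', (key F').1 h, rfl⟩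
  · rintro ⟨F', h, rfl⟩
    exact ⟨by rw [← hr]; exact Set.image_subset_range _ _, (key F').2 h⟩

end SpanningTrees

end CirculantFoliation

/-! ### The Laplacian of the base graph: positivity and cofactors -/

namespace CirculantFoliation

open Matrix Finset

section Laplacian

variable {V E R : Type*}

theorem exists_ends {H : Graph V E} : ∃ a b : E(H) → V, ∀ e : E(H), H.IsLink e (a e) (b e) := by
  have h (e : E(H)) : ∃ x y, H.IsLink e x y := H.exists_isLink_of_mem_edgeSet e.2
  choose a b hl using h
  exact ⟨a, b, hl⟩

theorem eq_of_connected {X : Type*} {H : Graph V E} (hV : V(H) = Set.univ)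
    (hconn : H.toSimpleGraph.Connected) {w : V → X} (hw : ∀ u v, H.Adj u v → w u = w v)
    (u v : V) : w u = w v := by
  have hm (u : V) : u ∈ V(H) := by rw [hV]; trivial
  obtain ⟨p⟩ := hconn.preconnected ⟨u, hm u⟩ ⟨v, hm v⟩
  suffices ∀ x y : V(H), H.toSimpleGraph.Walk x y → w x = w y from this _ _ p
  intro x y p
  induction p with
  | nil => rfl
  | cons hadj _ ih =>
    rw [Graph.toSimpleGraph_adj] at hadj
    exact (hw _ _ hadj.2).trans ih

variable [DecidableEq V]

theorem genLaplacian_apply [CommRing R] (H : Graph V E) (x : V → R) (u v : V) :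
    genLaplacian H x u v = (if u = v then x u else 0) - (mult H u v : R) := by
  simp [genLaplacian, diagonal_apply]

theorem map_genLaplacian {R' : Type*} [CommRing R] [CommRing R'] (f : R →+* R') (H : Graph V E)
    (x : V → R) : (genLaplacian H x).map f = genLaplacian H (fun u => f (x u)) := by
  ext u v
  simp [genLaplacian_apply, apply_ite f]

theorem map_det_genLaplacian {R' : Type*} [CommRing R] [CommRing R'] [Fintype V] (f : R →+* R')
    (H : Graph V E) (x : V → R) :
    f (genLaplacian H x).det = (genLaplacian H (fun u => f (x u))).det := by
  rw [RingHom.map_det, RingHom.mapMatrix_apply, map_genLaplacian]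

theorem mult_eq_sum {H : Graph V E} [hloop : H.Loopless] [Fintype E(H)] {a b : E(H) → V}
    (hl : ∀ e : E(H), H.IsLink e (a e) (b e)) (u v : V) :
    mult H u v = ∑ e, ((if u = a e ∧ v = b e then 1 else 0) +
      (if u = b e ∧ v = a e then 1 else 0)) := by
  classical
  have h1 : mult H u v = (univ.filter fun e : E(H) => H.IsLink e u v).card := by
    rw [mult, ← Set.ncard_coe_finset, ← Set.ncard_image_of_injective _ Subtype.val_injective]
    congr 1
    ext e
    simp only [Set.mem_ofPred_eq, coe_filter, mem_univ, true_and, Set.mem_image, Subtype.exists,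
      exists_and_left, exists_prop, exists_eq_right_right]
    exact ⟨fun h => ⟨h, h.edge_mem⟩, fun h => h.1⟩
  rw [h1, Finset.card_filter]
  refine Finset.sum_congr rfl fun e _ => ?_
  have hne := (hl e).ne
  have h2 : H.IsLink e u v ↔ (u = a e ∧ v = b e) ∨ (u = b e ∧ v = a e) := by
    rw [(hl e).isLink_iff]
    tauto
  rw [if_congr h2 rfl rfl]
  by_cases h : u = a e ∧ v = b e
  · have h' : ¬ (u = b e ∧ v = a e) := fun h' => hne (h.1.symm.trans h'.1)
    simp [h, hne]
  · simp [h]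

theorem genLaplacian_deg_apply [Fintype V] [CommRing R] {H : Graph V E} [H.Loopless]
    [Fintype E(H)] {a b : E(H) → V} (hl : ∀ e : E(H), H.IsLink e (a e) (b e)) (u v : V) :
    genLaplacian H (fun u => (deg H u : R)) u v =
      ∑ e, ((if u = b e then 1 else 0) - (if u = a e then 1 else 0)) *
        ((if v = b e then 1 else 0) - (if v = a e then 1 else 0)) := by
  have hd : deg H u = ∑ e, ((if u = a e then 1 else 0) + (if u = b e then 1 else 0)) := by
    rw [deg, Finset.sum_congr rfl fun v _ => mult_eq_sum hl u v, Finset.sum_comm]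
    refine Finset.sum_congr rfl fun e _ => ?_
    rw [Finset.sum_add_distrib]
    simp [ite_and]
  rw [genLaplacian_apply, hd, mult_eq_sum hl]
  push_cast
  by_cases h1 : u = v
  · subst h1
    rw [if_pos rfl, ← Finset.sum_sub_distrib]
    refine Finset.sum_congr rfl fun e _ => ?_
    have hne := (hl e).ne
    by_cases h2 : u = a e
    · simp [h2, hne]
    · by_cases h3 : u = b e
      · subst h3; simp [h2]
      · simp [h2, h3]
  · rw [if_neg h1, zero_sub, ← Finset.sum_neg_distrib]
    refine Finset.sum_congr rfl fun e _ => ?_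
    by_cases h2 : u = a e <;> by_cases h3 : u = b e <;> by_cases h4 : v = a e <;>
      by_cases h5 : v = b e <;> simp_all

theorem genLaplacian_add [CommRing R] (H : Graph V E) (x y : V → R) :
    genLaplacian H (fun u => x u + y u) = genLaplacian H x + diagonal y := by
  ext u v
  simp only [genLaplacian_apply, diagonal_apply, Matrix.add_apply]
  split_ifs <;> ring

theorem sum_genLaplacian_deg [Fintype V] [CommRing R] {H : Graph V E} (v : V) :
    ∑ u, genLaplacian H (fun u => (deg H u : R)) u v = 0 := by
  have h (u : V) : mult H u v = mult H v u := by
    simp only [mult, Graph.isLink_comm (x := u)]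
  simp [genLaplacian_apply, Finset.sum_sub_distrib, h, deg]

theorem dotProduct_genLaplacian_mulVec [Fintype V] {H : Graph V E} [H.Loopless]
    [Fintype E(H)] {a b : E(H) → V} (hl : ∀ e : E(H), H.IsLink e (a e) (b e)) (y w : V → ℝ) :
    w ⬝ᵥ (genLaplacian H (fun u => (deg H u : ℝ) + y u) *ᵥ w) =
      ∑ e, (w (b e) - w (a e)) ^ 2 + ∑ u, y u * w u ^ 2 := by
  rw [genLaplacian_add, add_mulVec, dotProduct_add]
  congr 1
  · simp only [dotProduct, mulVec, genLaplacian_deg_apply hl, Finset.sum_mul, Finset.mul_sum]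
    rw [Finset.sum_congr rfl fun u _ => Finset.sum_comm, Finset.sum_comm]
    refine Finset.sum_congr rfl fun e _ => ?_
    have h1 : w (b e) - w (a e) =
        ∑ u, w u * ((if u = b e then 1 else 0) - (if u = a e then 1 else 0)) := by
      simp [mul_sub, Finset.sum_sub_distrib]
    rw [h1, sq, Finset.sum_mul_sum]
    refine Finset.sum_congr rfl fun u _ => Finset.sum_congr rfl fun v _ => ?_
    ring
  · simp only [mulVec_diagonal, dotProduct]
    exact Finset.sum_congr rfl fun u _ => by ring

/-- Pairing with `w` gives a vanishing sum of nonnegative terms, so each term is zero; connectivity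
spreads equality along edges to all vertices. -/
theorem genLaplacian_ker [Fintype V] {H : Graph V E} [H.Loopless] (hV : V(H) = Set.univ)
    (hE : E(H).Finite) (hconn : H.toSimpleGraph.Connected) {y : V → ℝ} (hy : ∀ u, 0 ≤ y u)
    {w : V → ℝ} (hw : genLaplacian H (fun u => (deg H u : ℝ) + y u) *ᵥ w = 0) :
    (∀ u v, w u = w v) ∧ ∀ u, y u * w u ^ 2 = 0 := by
  have := hE.fintype
  obtain ⟨a, b, hl⟩ := exists_ends (H := H)
  have h := dotProduct_genLaplacian_mulVec hl y w
  rw [hw, dotProduct_zero] at h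
  have h1 : 0 ≤ ∑ e, (w (b e) - w (a e)) ^ 2 := Finset.sum_nonneg fun e _ => sq_nonneg _
  have h2 : ∀ u ∈ univ, 0 ≤ y u * w u ^ 2 := fun u _ => mul_nonneg (hy u) (sq_nonneg _)
  have h3 := Finset.sum_nonneg h2
  constructor
  · refine eq_of_connected hV hconn ?_
    rintro u v ⟨e, he⟩
    have h4 : ∑ e, (w (b e) - w (a e)) ^ 2 = 0 := by linarith
    rw [Finset.sum_eq_zero_iff_of_nonneg fun e _ => sq_nonneg _] at h4
    have h5 := h4 ⟨e, he.edge_mem⟩ (mem_univ _)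
    rw [sq_eq_zero_iff, sub_eq_zero] at h5
    rcases (hl ⟨e, he.edge_mem⟩).eq_and_eq_or_eq_and_eq he with ⟨h6, h7⟩ | ⟨h6, h7⟩
    · exact (congrArg w h6).symm.trans (h5.symm.trans (congrArg w h7))
    · exact (congrArg w h7).symm.trans (h5.trans (congrArg w h6))
  · have h4 : ∑ u, y u * w u ^ 2 = 0 := by linarith
    rw [Finset.sum_eq_zero_iff_of_nonneg h2] at h4
    exact fun u => h4 u (mem_univ u)

theorem det_genLaplacian_ne_zero [Fintype V] {H : Graph V E} [H.Loopless] (hV : V(H) = Set.univ)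
    (hE : E(H).Finite) (hconn : H.toSimpleGraph.Connected) {y : V → ℝ} (hy : ∀ u, 0 ≤ y u)
    (hne : ∃ u, y u ≠ 0) : (genLaplacian H (fun u => (deg H u : ℝ) + y u)).det ≠ 0 := by
  intro h
  obtain ⟨w, hw0, hw⟩ := exists_mulVec_eq_zero_iff.2 h
  obtain ⟨h1, h2⟩ := genLaplacian_ker hV hE hconn hy hw
  obtain ⟨u, hu⟩ := hne
  have h3 : w u = 0 := by simpa [hu] using h2 u
  exact hw0 (funext fun v => (h1 v u).trans h3)

/-- Adding all other rows to row `u₀` preserves the determinant. This is how common factors are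
extracted below. -/
theorem det_eq_det_updateRow_sum [Fintype V] [CommRing R] (M : Matrix V V R) (u₀ : V) {g : V → R}
    (hg : ∀ v, ∑ u, M u v = g v) : M.det = (M.updateRow u₀ g).det := by
  have h := det_updateRow_sum M u₀ fun _ => 1
  have h1 : (∑ k, (1 : R) • M k) = g := by
    ext v
    simp only [one_smul]
    exact (Finset.sum_apply v univ fun k => M k).trans (hg v)
  rw [h1, one_smul] at h
  exact h.symm

theorem det_updateRow_eq_sum_adjugate [Fintype V] [CommRing R] (M : Matrix V V R) (u₀ : V)
    (g : V → R) : (M.updateRow u₀ g).det = ∑ u, adjugate M u u₀ * g u := by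
  rw [← cramer_transpose_apply, cramer_eq_adjugate_mulVec, ← adjugate_transpose]
  simp [mulVec, dotProduct]

/-- All cofactors in a row of the Laplacian of a connected graph are the same nonzero number. -/
theorem exists_adjugate_genLaplacian_eq [Fintype V] {H : Graph V E} [H.Loopless]
    (hV : V(H) = Set.univ) (hE : E(H).Finite) (hconn : H.toSimpleGraph.Connected) (u₀ : V) :
    ∃ c : ℝ, c ≠ 0 ∧ ∀ u, adjugate (genLaplacian H (fun u => (deg H u : ℝ))) u u₀ = c := by
  set L := genLaplacian H (fun u => (deg H u : ℝ)) with hL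
  have hdet : L.det = 0 := by
    rw [det_eq_det_updateRow_sum L u₀ fun v => sum_genLaplacian_deg v]
    exact det_eq_zero_of_row_eq_zero u₀ (by simp)
  -- `L` is singular, so columns of its adjugate lie in its kernel, which consists of constants.
  have hker : L *ᵥ (fun u => adjugate L u u₀) = 0 := by
    ext u
    have := congrFun (congrFun (mul_adjugate L) u) u₀
    simpa [hdet, mul_apply, mulVec, dotProduct] using this
  have hL' : L = genLaplacian H (fun u => (deg H u : ℝ) + (0 : V → ℝ) u) := by simp [hL]
  rw [hL'] at hker
  have hc := (genLaplacian_ker hV hE hconn (fun _ => le_rfl) hker).1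
  rw [← hL'] at hc
  refine ⟨adjugate L u₀ u₀, fun h => ?_, fun u => hc u u₀⟩
  -- Adding `1` to the diagonal entry at `u₀` gives a nonsingular matrix whose determinant is this
  -- very cofactor.
  refine det_genLaplacian_ne_zero hV hE hconn (y := Pi.single u₀ 1) (fun u => ?_) ⟨u₀, by simp⟩ ?_
  · by_cases hu : u = u₀
    · subst hu; simp
    · simp [hu]
  rw [genLaplacian_add, ← hL, det_eq_det_updateRow_sum (g := Pi.single u₀ 1) _ u₀]
  · have : (L + diagonal (Pi.single u₀ 1)).updateRow u₀ (Pi.single u₀ 1) =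
        L.updateRow u₀ (Pi.single u₀ 1) := by
      ext i j
      by_cases hi : i = u₀
      · subst hi; simp
      · simp [diagonal_apply, hi]
    rw [this, det_updateRow_eq_sum_adjugate]
    simp [Pi.single_apply, h]
  · intro v
    simp only [Matrix.add_apply, Finset.sum_add_distrib, hL, sum_genLaplacian_deg, zero_add]
    simp [diagonal_apply]

theorem exists_det_updateRow_genLaplacian [Fintype V] {H : Graph V E} [H.Loopless]
    (hV : V(H) = Set.univ) (hE : E(H).Finite) (hconn : H.toSimpleGraph.Connected) (u₀ : V) :
    ∃ c : ℂ, c ≠ 0 ∧ ∀ g : V → ℂ,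
      ((genLaplacian H (fun u => (deg H u : ℂ))).updateRow u₀ g).det = c * ∑ u, g u := by
  obtain ⟨c, hc, h⟩ := exists_adjugate_genLaplacian_eq hV hE hconn u₀
  refine ⟨c, by exact_mod_cast hc, fun g => ?_⟩
  have h1 : genLaplacian H (fun u => (deg H u : ℂ)) =
      Complex.ofRealHom.mapMatrix (genLaplacian H (fun u => (deg H u : ℝ))) := by
    rw [RingHom.mapMatrix_apply, map_genLaplacian]; simp
  rw [det_updateRow_eq_sum_adjugate, h1, ← RingHom.map_adjugate, Finset.mul_sum]
  simp [h]

/-- The rows of the sum add up to a constant row; once its factor is pulled out, subtracting `t`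
times that row of ones clears `t` from the others. -/
theorem det_add_const [Fintype V] {K : Type*} [Field K] (M : Matrix V V K) (u₀ : V)
    (hM : ∀ v, ∑ u, M u v = 0) (t : K) :
    (M + Matrix.of fun _ _ => t).det =
      t * Fintype.card V * (M.updateRow u₀ fun _ => 1).det := by
  rw [det_eq_det_updateRow_sum (g := (t * Fintype.card V) • fun _ => 1) _ u₀, det_updateRow_smul]
  · congr 1
    refine det_eq_of_forall_row_eq_smul_add_const (fun u => if u = u₀ then 0 else t) u₀ (by simp) ?_
    intro i j
    by_cases hi : i = u₀
    · subst hi; simp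
    · simp [hi]
  · intro v
    simp [Finset.sum_add_distrib, hM, mul_comm]

end Laplacian

end CirculantFoliation

/-! ### Edges of the foliation and Fourier block decomposition -/

namespace CirculantFoliation

open Matrix Finset

noncomputable section

section FoliationEdges

variable {V E : Type*} {H : Graph V E} (S : V → Finset ℕ)

/-- The tails of the edges of the foliation. -/
def foliationTail (n : ℕ) (a : E(H) → V) :
    (ZMod n × E(H)) ⊕ (ZMod n × Σ u, S u) → ZMod n × V
  | Sum.inl (k, e) => (k, a e)
  | Sum.inr (k, ⟨u, _⟩) => (k, u)

/-- The heads of the edges of the foliation. -/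
def foliationHead (n : ℕ) (b : E(H) → V) :
    (ZMod n × E(H)) ⊕ (ZMod n × Σ u, S u) → ZMod n × V
  | Sum.inl (k, e) => (k, b e)
  | Sum.inr (k, ⟨u, s⟩) => (k + (s : ℕ), u)

/-- The edges of the foliation, as a subset of the ambient type of edges. -/
def foliationEdge (n : ℕ) :
    (ZMod n × E(H)) ⊕ (ZMod n × Σ u, S u) → (ZMod n × E) ⊕ (ZMod n × V × ℕ)
  | Sum.inl (k, e) => Sum.inl (k, e)
  | Sum.inr (k, ⟨u, s⟩) => Sum.inr (k, u, s)

theorem foliationEdge_injective (n : ℕ) : Function.Injective (foliationEdge (H := H) S n) := by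
  rintro (⟨k, e⟩ | ⟨k, u, s⟩) (⟨k', e'⟩ | ⟨k', u', s'⟩) h
  · simp only [foliationEdge, Sum.inl.injEq, Prod.mk.injEq, Subtype.val_inj] at h
    rw [h.1, h.2]
  · simp [foliationEdge] at h
  · simp [foliationEdge] at h
  · simp only [foliationEdge, Sum.inr.injEq, Prod.mk.injEq] at h
    obtain ⟨rfl, rfl, h⟩ := h
    rw [Subtype.val_inj] at h
    rw [h]

theorem foliation_isLink (hV : V(H) = Set.univ) {a b : E(H) → V}
    (hl : ∀ e : E(H), H.IsLink e (a e) (b e)) (n : ℕ)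
    (e : (ZMod n × E(H)) ⊕ (ZMod n × Σ u, S u)) :
    (foliation H S n).IsLink (foliationEdge S n e) (foliationTail S n a e)
      (foliationHead S n b e) := by
  rcases e with ⟨k, e⟩ | ⟨k, u, s⟩
  · exact ⟨rfl, rfl, hl e⟩
  · exact ⟨by rw [hV]; trivial, s.2, rfl⟩

theorem range_foliationEdge (hV : V(H) = Set.univ) (n : ℕ) :
    Set.range (foliationEdge (H := H) S n) = E(foliation H S n) := by
  ext e
  constructor
  · rintro ⟨e, rfl⟩
    obtain ⟨a, b, hl⟩ := exists_ends (H := H)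
    exact (foliation_isLink S hV hl n e).edge_mem
  · intro h
    obtain ⟨x, y, h⟩ := Graph.exists_isLink_of_mem_edgeSet h
    rcases e with ⟨k, e⟩ | ⟨k, u, s⟩
    · exact ⟨Sum.inl (k, ⟨e, h.2.2.edge_mem⟩), rfl⟩
    · exact ⟨Sum.inr (k, ⟨u, ⟨s, h.2.1⟩⟩), rfl⟩

end FoliationEdges

section Fourier

variable {V E : Type*} [Fintype V] [DecidableEq V] (H : Graph V E) (S : V → Finset ℕ)

/-- The value of `P` at the complex number `z`. -/
def symbol (z : ℂ) : ℂ :=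
  (genLaplacian H fun u => (deg H u : ℂ) + ∑ s ∈ S u, (2 - z ^ s - z⁻¹ ^ s)).det

variable (V) in
/-- The discrete Fourier transform in each fibre. -/
def fourierMatrix (n : ℕ) [NeZero n] : Matrix (ZMod n × V) (ZMod n × V) ℂ :=
  Matrix.of fun x y => if x.2 = y.2 then ZMod.stdAddChar (x.1 * y.1) else 0

theorem det_fourierMatrix_ne_zero (n : ℕ) [NeZero n] : (fourierMatrix V n).det ≠ 0 := by
  have h : fourierMatrix V n * (Matrix.of fun x y : ZMod n × V =>
      if x.2 = y.2 then (ZMod.stdAddChar (-(x.1 * y.1)) : ℂ) else 0) = (n : ℂ) • 1 := by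
    ext ⟨k, u⟩ ⟨l, v⟩
    have h1 := AddChar.sum_mulShift (k - l) (ZMod.isPrimitive_stdAddChar n)
    have h2 (i : ZMod n) : (ZMod.stdAddChar (k * i) : ℂ) * ZMod.stdAddChar (-(i * l)) =
        ZMod.stdAddChar (i * (k - l)) := by
      rw [← AddChar.map_add_eq_mul]; congr 1; ring
    rw [ZMod.card] at h1
    by_cases huv : u = v
    · by_cases hkl : k = l
      · subst hkl
        simp [fourierMatrix, mul_apply, Fintype.sum_prod_type, huv, h2]
      · rw [if_neg (sub_ne_zero.2 hkl), Nat.cast_zero] at h1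
        simpa [fourierMatrix, mul_apply, Fintype.sum_prod_type, huv, hkl, h2] using h1
    · simp [fourierMatrix, mul_apply, Fintype.sum_prod_type, huv]
  intro h0
  have h1 := congrArg det h
  rw [det_mul, h0, zero_mul, det_smul, det_one, mul_one] at h1
  exact pow_ne_zero _ (Nat.cast_ne_zero.2 (NeZero.ne n)) h1.symm

/-- The block of the Laplacian of the foliation at a frequency. -/
def fourierBlock (n : ℕ) [NeZero n] (j : ZMod n) : Matrix V V ℂ :=
  genLaplacian H (fun u => (deg H u : ℂ) + ∑ s ∈ S u,
    (2 - ZMod.stdAddChar j ^ s - (ZMod.stdAddChar j)⁻¹ ^ s)) +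
  Matrix.of fun _ _ => if j = 0 then (n : ℂ) else 0

variable {H}

/-- A shift by `s` in `ℤ/n` acts on the character of frequency `j` as multiplication by its `s`-th
power, so frequencies do not mix. The column of ones sees only frequency `0`, by orthogonality of
characters. -/
theorem fourier_intertwining [H.Loopless] [Fintype E(H)] {a b : E(H) → V}
    (hl : ∀ e : E(H), H.IsLink e (a e) (b e)) (n : ℕ) [NeZero n] :
    (augIncidence (foliationTail S n a) (foliationHead S n b) *
      (augIncidence (foliationTail S n a) (foliationHead S n b))ᵀ).map (Int.castRingHom ℂ) *
        fourierMatrix V n =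
      fourierMatrix V n *
        (blockDiagonal (fourierBlock H S n)).submatrix Prod.swap Prod.swap := by
  have hχ (j : ZMod n) (s : ℕ) : (ZMod.stdAddChar j : ℂ) ^ s = ZMod.stdAddChar ((s : ZMod n) * j) := by
    rw [← AddChar.map_nsmul_eq_pow, nsmul_eq_mul]
  have hχ' (j : ZMod n) (s : ℕ) : (ZMod.stdAddChar j : ℂ)⁻¹ ^ s = ZMod.stdAddChar (-((s : ZMod n) * j)) := by
    rw [← AddChar.map_neg_eq_inv, hχ, mul_neg]
  rw [Matrix.map_mul, Matrix.mul_assoc]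
  ext ⟨k, u⟩ ⟨j, v⟩
  have h1 (e) : ((augIncidence (foliationTail S n a) (foliationHead S n b))ᵀ.map
      (Int.castRingHom ℂ) * fourierMatrix V n) (some e) (j, v) =
        fourierMatrix V n (foliationHead S n b e) (j, v) -
          fourierMatrix V n (foliationTail S n a e) (j, v) := by
    simp [mul_apply, augIncidence, sub_mul, Finset.sum_sub_distrib]
  have h0 : ((augIncidence (foliationTail S n a) (foliationHead S n b))ᵀ.map
      (Int.castRingHom ℂ) * fourierMatrix V n) none (j, v) = if j = 0 then (n : ℂ) else 0 := by
    have h := AddChar.sum_mulShift j (ZMod.isPrimitive_stdAddChar n)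
    rw [ZMod.card] at h
    simpa [mul_apply, augIncidence, fourierMatrix, Fintype.sum_prod_type] using h
  have hR : (fourierMatrix V n *
        (blockDiagonal (fourierBlock H S n)).submatrix Prod.swap Prod.swap) (k, u) (j, v) =
      ZMod.stdAddChar (k * j) * fourierBlock H S n j u v := by
    simp [mul_apply, fourierMatrix, Fintype.sum_prod_type, blockDiagonal_apply]
  rw [hR, mul_apply, Fintype.sum_option, h0]
  simp only [h1]
  have h2 : fourierBlock H S n j u v = (if j = 0 then (n : ℂ) else 0) +
      (genLaplacian H (fun u => (deg H u : ℂ)) u v + if u = v then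
        ∑ s ∈ S u, (2 - ZMod.stdAddChar j ^ s - (ZMod.stdAddChar j)⁻¹ ^ s) else 0) := by
    rw [fourierBlock, genLaplacian_add]
    simp [diagonal_apply]
    ring
  rw [h2, mul_add, genLaplacian_deg_apply hl]
  congr 1
  · by_cases hj : j = 0
    · simp [hj, augIncidence]
    · simp [hj]
  rw [mul_add, Fintype.sum_sum_type]
  congr 1
  · simp only [Fintype.sum_prod_type, foliationHead, foliationTail, fourierMatrix, of_apply,
      augIncidence, map_apply, Option.elim, Prod.mk.injEq, ite_and, eq_intCast]
    rw [Finset.sum_comm, Finset.mul_sum]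
    refine Finset.sum_congr rfl fun e _ => ?_
    rw [Finset.sum_eq_single_of_mem k (mem_univ k)]
    · simp only [if_true, eq_comm (b := v)]
      push_cast
      split_ifs <;> simp
    · intro i _ hi
      simp [hi.symm]
  · simp only [Fintype.sum_prod_type, foliationHead, foliationTail, fourierMatrix, of_apply,
      augIncidence, map_apply, Option.elim, Prod.mk.injEq, eq_intCast]
    rw [Finset.sum_comm, Fintype.sum_sigma]
    by_cases huv : u = v
    · subst huv
      rw [Finset.sum_eq_single_of_mem u (mem_univ u)]
      · rw [if_pos rfl, Finset.mul_sum, ← Finset.sum_coe_sort (S u)]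
        refine Finset.sum_congr rfl fun s _ => ?_
        have hk (i : ZMod n) : k = i + ((s : ℕ) : ZMod n) ↔ k - (s : ℕ) = i := by
          rw [sub_eq_iff_eq_add]
        simp only [and_true, if_true, hk]
        push_cast
        simp only [sub_mul, Finset.sum_sub_distrib, ite_mul, one_mul, zero_mul, Finset.sum_ite_eq,
          mem_univ, if_true, hχ, hχ', mul_sub, ← AddChar.map_add_eq_mul]
        ring_nf
      · intro w _ hw
        simp [hw.symm]
    · rw [if_neg huv, mul_zero]
      refine Finset.sum_eq_zero fun w _ => Finset.sum_eq_zero fun s _ =>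
        Finset.sum_eq_zero fun i _ => ?_
      by_cases hw : u = w
      · subst hw; simp [huv]
      · simp [hw]

/-- The number of spanning trees of the foliation, in terms of the determinants of its Fourier
blocks. -/
theorem numSpanningTrees_foliation_eq_prod_det [Nonempty V] [H.Loopless] (hV : V(H) = Set.univ)
    (hE : E(H).Finite) (n : ℕ) [NeZero n] :
    ((n : ℂ) * Fintype.card V) ^ 2 * numSpanningTrees (foliation H S n) =
      ∏ j, (fourierBlock H S n j).det := by
  have := hE.fintype
  obtain ⟨a, b, hl⟩ := exists_ends (H := H)
  have hV' : V(foliation H S n) = Set.univ := by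
    ext x; simp [foliation, hV]
  have h1 := card_sq_mul_numSpanningTrees hV' (foliationEdge_injective S n)
    (range_foliationEdge S hV n) (foliation_isLink S hV hl n)
  have h2 := congrArg det (fourier_intertwining S hl n)
  rw [det_mul, det_mul, mul_comm] at h2
  have h3 := mul_left_cancel₀ (det_fourierMatrix_ne_zero n) h2
  have h4 := congrArg (Int.castRingHom ℂ) h1
  rw [RingHom.map_det, RingHom.mapMatrix_apply, h3] at h4
  have h5 : ((blockDiagonal (fourierBlock H S n)).submatrix Prod.swap Prod.swap).det =
      (blockDiagonal (fourierBlock H S n)).det :=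
    det_submatrix_equiv_self (Equiv.prodComm (ZMod n) V) _
  rw [h5, det_blockDiagonal] at h4
  rw [← h4]
  simp [ZMod.card]

theorem numSpanningTrees_foliation_eq [Nonempty V] [H.Loopless] (hV : V(H) = Set.univ)
    (hE : E(H).Finite) (n : ℕ) [NeZero n] {c : ℂ} {u₀ : V}
    (hc : ∀ g : V → ℂ,
      ((genLaplacian H (fun u => (deg H u : ℂ))).updateRow u₀ g).det = c * ∑ u, g u) :
    (n : ℂ) * numSpanningTrees (foliation H S n) =
      c * ∏ j ∈ univ.erase (0 : ZMod n), symbol H S (ZMod.stdAddChar j) := by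
  have h := numSpanningTrees_foliation_eq_prod_det S hV hE n
  rw [← Finset.mul_prod_erase univ _ (mem_univ (0 : ZMod n))] at h
  have h0 : (fourierBlock H S n 0).det = n * Fintype.card V * (c * Fintype.card V) := by
    have h1 : fourierBlock H S n 0 =
        genLaplacian H (fun u => (deg H u : ℂ)) + Matrix.of fun _ _ => (n : ℂ) := by
      rw [fourierBlock]
      congr 2
      · ext u
        norm_num
      · ext; simp
    rw [h1, det_add_const _ u₀ sum_genLaplacian_deg, hc]
    simp
  have h1 : ∏ j ∈ univ.erase (0 : ZMod n), (fourierBlock H S n j).det =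
      ∏ j ∈ univ.erase (0 : ZMod n), symbol H S (ZMod.stdAddChar j) := by
    refine Finset.prod_congr rfl fun j hj => ?_
    rw [fourierBlock, symbol]
    congr 1
    ext u v
    simp [(Finset.mem_erase.1 hj).1]
  rw [h0, h1] at h
  have hn : (n : ℂ) ≠ 0 := Nat.cast_ne_zero.2 (NeZero.ne n)
  have hm : (Fintype.card V : ℂ) ≠ 0 := Nat.cast_ne_zero.2 Fintype.card_ne_zero
  have h2 : (n : ℂ) * Fintype.card V ^ 2 ≠ 0 := mul_ne_zero hn (pow_ne_zero 2 hm)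
  apply mul_left_cancel₀ h2
  linear_combination h

end Fourier

end

end CirculantFoliation

/-! ### The symbol on the unit circle and its double zero at 1 -/

namespace CirculantFoliation

open Matrix Finset

noncomputable section

/-- Otherwise the order of `z` would divide every jump, hence their gcd. -/
theorem exists_jump_pow_ne_one {V : Type*} [Fintype V] {S : V → Finset ℕ}
    (hgcd : (Finset.univ.biUnion S).gcd id = 1) {z : ℂ}
    (hz : z ≠ 1) :
    ∃ u, ∃ s ∈ S u, z ^ s ≠ 1 := by
  by_contra! h
  have h1 : orderOf z ∣ (Finset.univ.biUnion S).gcd id := by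
    refine Finset.dvd_gcd fun s hs => ?_
    obtain ⟨u, -, hs⟩ := Finset.mem_biUnion.1 hs
    exact orderOf_dvd_of_pow_eq_one (h u s hs)
  rw [hgcd, Nat.dvd_one, orderOf_eq_one_iff] at h1
  exact hz h1

theorem q_pos {V : Type*} [Fintype V] {S : V → Finset ℕ} (hpos : ∀ u, ∀ s ∈ S u, 1 ≤ s)
    (hgcd : (Finset.univ.biUnion S).gcd id = 1) :
    0 < q S := by
  -- Only the existence of a jump is wanted; any `z ≠ 1` would serve.
  obtain ⟨u, s, hs, -⟩ := exists_jump_pow_ne_one hgcd (z := 0) zero_ne_one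
  have h1 := hpos u s hs
  exact Finset.sum_pos' (fun _ _ => Nat.zero_le _)
    ⟨u, mem_univ u, Finset.sum_pos' (fun _ _ => Nat.zero_le _) ⟨s, hs, by positivity⟩⟩

section Symbol

variable {V E : Type*} [Fintype V] [DecidableEq V] (H : Graph V E) (S : V → Finset ℕ)

theorem eval₂_P (z : ℂˣ) :
    LaurentPolynomial.eval₂ (RingHom.id ℂ) z (P H S) = symbol H S z := by
  rw [P, map_det_genLaplacian, symbol]
  congr 2
  ext u
  simp only [map_sub, map_natCast, map_sum, map_add, LaurentPolynomial.eval₂_T_n,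
    LaurentPolynomial.eval₂_T_neg_n]
  push_cast
  simp only [Finset.sum_sub_distrib, Finset.sum_add_distrib, Finset.sum_const, nsmul_eq_mul]
  simp
  ring

theorem eval_eq_pow_mul_symbol {N : ℕ} {p : Polynomial ℂ}
    (hp : Polynomial.toLaurent p = LaurentPolynomial.T (N : ℤ) * P H S) {z : ℂ} (hz : z ≠ 0) :
    p.eval z = z ^ N * symbol H S z := by
  have h := congrArg (LaurentPolynomial.eval₂ (RingHom.id ℂ) (Units.mk0 z hz)) hp
  rw [LaurentPolynomial.eval₂_toLaurent, map_mul, LaurentPolynomial.eval₂_T_n, eval₂_P] at h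
  simpa [Polynomial.eval₂_id] using h

theorem eval_Q_cos (θ : ℝ) : (Q H S).eval (Real.cos θ) =
    (genLaplacian H fun u => (deg H u : ℝ) + ∑ s ∈ S u, (2 - 2 * Real.cos (s * θ))).det := by
  rw [← Polynomial.coe_evalRingHom, Q, map_det_genLaplacian]
  congr 2
  ext u
  simp only [map_sub, map_natCast, map_sum, map_mul, Polynomial.coe_evalRingHom,
    Polynomial.Chebyshev.T_real_cos, Finset.sum_sub_distrib, Finset.sum_const, nsmul_eq_mul]
  push_cast
  simp
  ring

theorem symbol_exp (θ : ℝ) :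
    symbol H S (Complex.exp (θ * Complex.I)) = ((Q H S).eval (Real.cos θ) : ℝ) := by
  rw [eval_Q_cos, symbol]
  refine Eq.trans ?_ (map_det_genLaplacian Complex.ofRealHom H _).symm
  congr 2
  ext u
  simp only [map_add, map_natCast, map_sum, map_sub, map_mul, Complex.ofRealHom_eq_coe,
    map_ofNat]
  congr 1
  refine Finset.sum_congr rfl fun s _ => ?_
  rw [← Complex.exp_neg, ← Complex.exp_nat_mul, ← Complex.exp_nat_mul]
  push_cast
  rw [Complex.cos]
  ring_nf

theorem norm_symbol_exp (θ : ℝ) :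
    ‖symbol H S (Complex.exp (θ * Complex.I))‖ = |(Q H S).eval (Real.cos θ)| := by
  rw [symbol_exp, Complex.norm_real, Real.norm_eq_abs]

variable {H S}

theorem symbol_ne_zero [H.Loopless] (hV : V(H) = Set.univ) (hE : E(H).Finite)
    (hconn : H.toSimpleGraph.Connected) (hgcd : (Finset.univ.biUnion S).gcd id = 1)
    {z : ℂ} (hz : ‖z‖ = 1) (hz1 : z ≠ 1) : symbol H S z ≠ 0 := by
  obtain ⟨θ, rfl⟩ := (Complex.norm_eq_one_iff z).1 hz
  rw [symbol_exp, Complex.ofReal_ne_zero, eval_Q_cos]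
  have hnn (s : ℕ) : 0 ≤ 2 - 2 * Real.cos (s * θ) := by linarith [Real.cos_le_one (s * θ)]
  refine det_genLaplacian_ne_zero hV hE hconn (fun u => Finset.sum_nonneg fun s _ => hnn s) ?_
  obtain ⟨u, s, hs, h⟩ := exists_jump_pow_ne_one hgcd hz1
  refine ⟨u, fun h0 => h ?_⟩
  rw [Finset.sum_eq_zero_iff_of_nonneg fun s _ => hnn s] at h0
  have hcos : Real.cos (s * θ) = 1 := by linarith [h0 s hs]
  have hsin : Real.sin (s * θ) = 0 := by
    have := Real.sin_sq_add_cos_sq (s * θ)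
    rw [hcos] at this
    simpa using this
  have h2 : (s : ℂ) * (θ * Complex.I) = ((s * θ : ℝ) : ℂ) * Complex.I := by push_cast; ring
  rw [← Complex.exp_nat_mul, h2, Complex.exp_mul_I, ← Complex.ofReal_cos, ← Complex.ofReal_sin,
    hcos, hsin]
  simp

end Symbol

section Factorization

variable {V E : Type*} [Fintype V] [DecidableEq V] {H : Graph V E} {S : V → Finset ℕ}

open LaurentPolynomial in
-- The left side is `-z^(-s) (z^s - 1)²`. The cofactor of `(z - 1)²` takes the value `-s²` at `1`,
-- the source of `q`.
theorem two_sub_T_sub_T_neg (s : ℕ) : (2 : LaurentPolynomial ℂ) - T (s : ℤ) - T (-(s : ℤ)) =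
    (T 1 - 1) ^ 2 * -(T (-(s : ℤ)) * (∑ i ∈ range s, T 1 ^ i) ^ 2) := by
  have h1 : (T 1 - 1) * ∑ i ∈ range s, (T 1 : LaurentPolynomial ℂ) ^ i = T (s : ℤ) - 1 := by
    rw [mul_geom_sum, T_pow, mul_one]
  have h2 : (T (s : ℤ) : LaurentPolynomial ℂ) * T (-(s : ℤ)) = 1 := by
    rw [← T_add]; simp
  have h3 : (T 1 - 1) ^ 2 * -(T (-(s : ℤ)) * (∑ i ∈ range s, (T 1 : LaurentPolynomial ℂ) ^ i) ^ 2)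
      = -(T (-(s : ℤ)) * ((T 1 - 1) * ∑ i ∈ range s, (T 1 : LaurentPolynomial ℂ) ^ i) ^ 2) := by
    ring
  rw [h3, h1]
  linear_combination (T (s : ℤ) - 2) * h2

open LaurentPolynomial in
/-- The Laurent polynomial `P` has a zero of order exactly two at `1`. -/
theorem exists_toLaurent_eq {c : ℂ} {u₀ : V}
    (hc : ∀ g : V → ℂ,
      ((genLaplacian H (fun u => (deg H u : ℂ))).updateRow u₀ g).det = c * ∑ u, g u) :
    ∃ (N : ℕ) (r : Polynomial ℂ),
      Polynomial.toLaurent ((Polynomial.X - 1) ^ 2 * r) = T (N : ℤ) * P H S ∧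
        r.eval 1 = -(c * q S) := by
  set g : V → LaurentPolynomial ℂ := fun u =>
    ∑ s ∈ S u, -(T (-(s : ℤ)) * (∑ i ∈ range s, T 1 ^ i) ^ 2) with hg
  set M : Matrix V V (LaurentPolynomial ℂ) :=
    genLaplacian H (fun u => (deg H u : LaurentPolynomial ℂ) + (T 1 - 1) ^ 2 * g u) with hM
  have hP : P H S = M.det := by
    rw [P, hM]
    congr 2
    ext1 u
    rw [hg]
    simp only [Finset.mul_sum, ← two_sub_T_sub_T_neg]
    push_cast
    simp only [Finset.sum_sub_distrib, Finset.sum_add_distrib, Finset.sum_const, nsmul_eq_mul]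
    ring
  -- The Laplacian part has zero column sums, so the summed row is `(z - 1)² g`.
  have hdet : M.det = (T 1 - 1) ^ 2 * (M.updateRow u₀ g).det := by
    rw [det_eq_det_updateRow_sum (g := ((T 1 - 1) ^ 2 : LaurentPolynomial ℂ) • g) M u₀,
      det_updateRow_smul]
    intro v
    rw [hM, genLaplacian_add]
    simp [Finset.sum_add_distrib, sum_genLaplacian_deg, diagonal_apply]
  obtain ⟨N, r, hr⟩ := exists_T_pow (M.updateRow u₀ g).det
  refine ⟨N, r, ?_, ?_⟩
  · rw [map_mul, map_pow, map_sub, Polynomial.toLaurent_X, map_one, hr, hP, hdet]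
    ring
  · have h := congrArg (eval₂ (RingHom.id ℂ) 1) hr
    rw [eval₂_toLaurent, map_mul, eval₂_T_n, RingHom.map_det, RingHom.mapMatrix_apply] at h
    have h1 : (M.updateRow u₀ g).map (eval₂ (RingHom.id ℂ) 1) =
        (genLaplacian H (fun u => (deg H u : ℂ))).updateRow u₀
          (fun u => -∑ s ∈ S u, (s : ℂ) ^ 2) := by
      have hT (k : ℤ) : eval₂ (RingHom.id ℂ) 1 (T k) = 1 := by rw [eval₂_T]; simp
      rw [map_updateRow, hM, map_genLaplacian]
      have h2 : (fun u => eval₂ (RingHom.id ℂ) 1 ((deg H u : LaurentPolynomial ℂ) +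
          (T 1 - 1) ^ 2 * g u)) = fun u => (deg H u : ℂ) := by
        ext u; simp [hT]
      have h3 : eval₂ (RingHom.id ℂ) 1 ∘ g = fun u => -∑ s ∈ S u, (s : ℂ) ^ 2 := by
        ext u; simp [hg, hT]
      rw [h2, h3]
    rw [h1, hc] at h
    simpa [Polynomial.eval₂_id, q] using h

end Factorization

/-! ### Products over roots of unity and the Mahler measure -/

section RootsOfUnity

open Polynomial Filter Topology

theorem prod_X_sub_C_stdAddChar (n : ℕ) [NeZero n] :
    ∏ j : ZMod n, (X - C (ZMod.stdAddChar j : ℂ)) = X ^ n - 1 := by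
  have hn := NeZero.pos n
  have h := Complex.isPrimitiveRoot_exp n (NeZero.ne n)
  rw [X_pow_sub_one_eq_prod hn h,
    ← Finset.prod_image (s := univ) (g := fun j : ZMod n => (ZMod.stdAddChar j : ℂ))
      (f := fun z => X - C z) ZMod.injective_stdAddChar.injOn]
  congr 1
  refine Finset.eq_of_subset_of_card_le ?_ ?_
  · intro z hz
    obtain ⟨j, -, rfl⟩ := Finset.mem_image.1 hz
    rw [mem_nthRootsFinset hn, ← AddChar.map_nsmul_eq_pow]
    simp
  · rw [h.card_nthRootsFinset, Finset.card_image_of_injective _ ZMod.injective_stdAddChar]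
    simp

theorem prod_stdAddChar_sub_one (n : ℕ) [NeZero n] :
    ∏ j ∈ univ.erase (0 : ZMod n), ‖(ZMod.stdAddChar j : ℂ) - 1‖ = n := by
  have h := prod_X_sub_C_stdAddChar n
  rw [← Finset.mul_prod_erase univ _ (mem_univ (0 : ZMod n)), AddChar.map_zero_eq_one, C_1,
    ← mul_geom_sum] at h
  have h1 := congrArg (fun p => ‖p.eval 1‖) (mul_left_cancel₀ (X_sub_C_ne_zero (1 : ℂ)) h)
  simpa [eval_prod, eval_finsetSum, norm_sub_rev] using h1

/-- Factor `r` over its roots and exchange the two products: for each root `α`, the product of `α -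
ζ^j` over `j` is `α^n - 1`. -/
theorem prod_norm_eval_stdAddChar (r : ℂ[X]) (n : ℕ) [NeZero n] :
    ∏ j : ZMod n, ‖r.eval (ZMod.stdAddChar j : ℂ)‖ =
      ‖r.leadingCoeff‖ ^ n * (r.roots.map fun α => ‖α ^ n - 1‖).prod := by
  have h1 (z : ℂ) : ‖r.eval z‖ = ‖r.leadingCoeff‖ * (r.roots.map fun α => ‖α - z‖).prod := by
    conv_lhs => rw [(IsAlgClosed.splits r).eq_prod_roots]
    rw [eval_mul, eval_C, norm_mul, eval_multiset_prod, Multiset.map_map]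
    congr 1
    refine (map_multiset_prod (normHom : ℂ →*₀ ℝ) _).trans ?_
    rw [Multiset.map_map]
    congr 2
    ext α
    simp [norm_sub_rev]
  simp only [h1, Finset.prod_mul_distrib, Finset.prod_const, Finset.card_univ, ZMod.card]
  rw [← Multiset.prod_map_prod]
  congr 3
  ext α
  rw [← norm_prod]
  congr 1
  have h2 := congrArg (eval α) (prod_X_sub_C_stdAddChar n)
  simpa [eval_prod] using h2

theorem tendsto_norm_pow_sub_one_div {α : ℂ} (hα : ‖α‖ ≠ 1) :
    Tendsto (fun n : ℕ => ‖α ^ n - 1‖ / max 1 ‖α‖ ^ n) atTop (𝓝 1) := by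
  rcases lt_or_gt_of_ne hα with h | h
  · have h1 : Tendsto (fun n : ℕ => ‖α ^ n - 1‖) atTop (𝓝 ‖(0 : ℂ) - 1‖) :=
      ((tendsto_pow_atTop_nhds_zero_of_norm_lt_one h).sub_const 1).norm
    simpa [max_eq_left h.le] using h1
  · have h0 : α ≠ 0 := by rintro rfl; simp at h; linarith
    have h1 : Tendsto (fun n : ℕ => ‖1 - α⁻¹ ^ n‖) atTop (𝓝 ‖(1 : ℂ) - 0‖) := by
      refine ((tendsto_pow_atTop_nhds_zero_of_norm_lt_one ?_).const_sub 1).norm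
      rw [norm_inv]
      exact inv_lt_one_of_one_lt₀ h
    simp only [sub_zero, norm_one] at h1
    refine h1.congr fun n => ?_
    rw [max_eq_right h.le, ← norm_pow, ← norm_div, sub_div, div_self (pow_ne_zero n h0), inv_pow,
      one_div]

/-- The product of the values at the `n`-th roots of unity of a polynomial without zeros on the
unit circle is asymptotic to the `n`-th power of the Mahler measure. -/
theorem tendsto_prod_norm_eval_div_mahlerMeasure (r : ℂ[X]) (hr : ∀ z, ‖z‖ = 1 → r.eval z ≠ 0) :
    Tendsto (fun n : ℕ => (‖r.leadingCoeff‖ ^ n * (r.roots.map fun α => ‖α ^ n - 1‖).prod) /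
      r.mahlerMeasure ^ n) atTop (𝓝 1) := by
  have h0 : r ≠ 0 := by
    rintro rfl
    exact hr 1 norm_one (by simp)
  have h1 (n : ℕ) : (‖r.leadingCoeff‖ ^ n * (r.roots.map fun α => ‖α ^ n - 1‖).prod) /
      r.mahlerMeasure ^ n = (r.roots.map fun α => ‖α ^ n - 1‖ / max 1 ‖α‖ ^ n).prod := by
    rw [mahlerMeasure_eq_leadingCoeff_mul_prod_roots, mul_pow, mul_div_mul_left,
      Multiset.prod_map_div, Multiset.prod_map_pow]
    exact pow_ne_zero n (norm_ne_zero_iff.2 (leadingCoeff_ne_zero.2 h0))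
  simp only [h1]
  have h2 := tendsto_multiset_prod (f := fun (α : ℂ) (n : ℕ) => ‖α ^ n - 1‖ / max 1 ‖α‖ ^ n)
    (x := atTop) (a := fun _ => (1 : ℝ)) r.roots fun α hα =>
      tendsto_norm_pow_sub_one_div fun hn => hr α hn ((mem_roots h0).1 hα)
  simpa using h2

end RootsOfUnity

end

end CirculantFoliation

/-! ### Identification of `A` and the asymptotics -/

namespace CirculantFoliation

open Finset Filter Topology

section Asymptotics

variable {V E : Type*} [Fintype V] [DecidableEq V] {H : Graph V E} {S : V → Finset ℕ}

theorem norm_eval_circleMap {N : ℕ} {p : Polynomial ℂ}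
    (hp : Polynomial.toLaurent p = LaurentPolynomial.T (N : ℤ) * P H S) (θ : ℝ) :
    ‖p.eval (circleMap 0 1 θ)‖ = |(Q H S).eval (Real.cos θ)| := by
  have h : circleMap 0 1 θ = Complex.exp (θ * Complex.I) := by simp [circleMap]
  rw [h, eval_eq_pow_mul_symbol H S hp (Complex.exp_ne_zero _), norm_mul, norm_pow,
    Complex.norm_exp_ofReal_mul_I, one_pow, one_mul, norm_symbol_exp]

theorem intervalIntegrable_log_abs_eval_Q {N : ℕ} {p : Polynomial ℂ}
    (hp : Polynomial.toLaurent p = LaurentPolynomial.T (N : ℤ) * P H S) :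
    IntervalIntegrable (fun t : ℝ => Real.log |(Q H S).eval (Real.cos (2 * Real.pi * t))|)
      MeasureTheory.volume 0 1 := by
  have h := p.intervalIntegrable_mahlerMeasure
  simp only [norm_eval_circleMap hp] at h
  simpa [Real.pi_ne_zero] using h.comp_mul_left (c := 2 * Real.pi)

theorem mahlerMeasure_eq_A {N : ℕ} {p : Polynomial ℂ}
    (hp : Polynomial.toLaurent p = LaurentPolynomial.T (N : ℤ) * P H S) (hp0 : p ≠ 0) :
    p.mahlerMeasure = A H S := by
  rw [Polynomial.mahlerMeasure_def_of_ne_zero hp0, A]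
  simp only [norm_eval_circleMap hp]
  rw [intervalIntegral.integral_comp_mul_left
    (fun x => Real.log |(Q H S).eval (Real.cos x)|) (by positivity : 2 * Real.pi ≠ 0)]
  simp

/-- The factors `(ζ^j - 1)²` contribute `n²`, and including `j = 0` in the product of `r` costs
`|r(1)| = |c| q`, which removes `c`. -/
theorem numSpanningTrees_foliation_eq_prod_norm [Nonempty V] [H.Loopless]
    (hV : V(H) = Set.univ) (hE : E(H).Finite) {c : ℂ} {u₀ : V}
    (hc : ∀ g : V → ℂ,
      ((genLaplacian H (fun u => (deg H u : ℂ))).updateRow u₀ g).det = c * ∑ u, g u)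
    {N : ℕ} {r : Polynomial ℂ}
    (hr : Polynomial.toLaurent ((Polynomial.X - 1) ^ 2 * r) =
      LaurentPolynomial.T (N : ℤ) * P H S)
    (hr1 : r.eval 1 = -(c * q S)) (hq : 0 < q S) (n : ℕ) [NeZero n] :
    (numSpanningTrees (foliation H S n) : ℝ) =
      n / q S * ∏ j : ZMod n, ‖r.eval (ZMod.stdAddChar j : ℂ)‖ := by
  have h := congrArg norm (numSpanningTrees_foliation_eq S hV hE n hc)
  rw [norm_mul, norm_mul, Complex.norm_natCast, Complex.norm_natCast, norm_prod] at h
  have h1 (j : ZMod n) : ‖symbol H S (ZMod.stdAddChar j)‖ =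
      ‖(ZMod.stdAddChar j : ℂ) - 1‖ ^ 2 * ‖r.eval (ZMod.stdAddChar j : ℂ)‖ := by
    have hn : ‖(ZMod.stdAddChar j : ℂ)‖ = 1 := AddChar.norm_apply _ _
    have h2 := eval_eq_pow_mul_symbol H S hr (z := ZMod.stdAddChar j)
      (norm_ne_zero_iff.1 (by rw [hn]; exact one_ne_zero))
    have h3 := congrArg norm h2
    rw [norm_mul, norm_pow, hn, one_pow, one_mul] at h3
    rw [← h3]
    simp
  simp only [h1] at h
  rw [Finset.prod_mul_distrib, Finset.prod_pow, prod_stdAddChar_sub_one] at h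
  rw [← Finset.mul_prod_erase univ _ (mem_univ (0 : ZMod n)), AddChar.map_zero_eq_one, hr1,
    norm_neg, norm_mul, Complex.norm_natCast]
  have hn : (n : ℝ) ≠ 0 := Nat.cast_ne_zero.2 (NeZero.ne n)
  have hq' : (q S : ℝ) ≠ 0 := by exact_mod_cast hq.ne'
  field_simp
  apply mul_left_cancel₀ hn
  linear_combination h

end Asymptotics

end CirculantFoliation

theorem theorem3 {V E : Type*} [Fintype V] [DecidableEq V]
    -- a finite connected graph `H` on the vertex set `V`, with multiple edges but without loops
    (H : Graph V E) (hV : V(H) = Set.univ) (hE : E(H).Finite) (hloop : H.Loopless)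
    (hconn : H.toSimpleGraph.Connected)
    -- the (possibly empty) sets of jumps, with greatest common divisor 1 of all jumps
    (S : V → Finset ℕ) (hpos : ∀ u, ∀ s ∈ S u, 1 ≤ s)
    (hgcd : (Finset.univ.biUnion S).gcd id = 1) :
    -- the integral in the definition of `A` converges
    IntervalIntegrable
        (fun t : ℝ => Real.log |(CirculantFoliation.Q H S).eval (Real.cos (2 * Real.pi * t))|)
        MeasureTheory.volume 0 1 ∧
    -- `A` is the Mahler measure of the Laurent polynomial `P`, that is, of each `z ^ N * P(z)`
    -- that is a polynomial
    (∀ (N : ℕ) (p : Polynomial ℂ),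
        Polynomial.toLaurent p = LaurentPolynomial.T (N : ℤ) * CirculantFoliation.P H S →
          p.mahlerMeasure = CirculantFoliation.A H S) ∧
    -- the asymptotics
    Asymptotics.IsEquivalent Filter.atTop
      (fun n : ℕ =>
        (CirculantFoliation.numSpanningTrees (CirculantFoliation.foliation H S n) : ℝ))
      (fun n : ℕ => (n : ℝ) / (CirculantFoliation.q S : ℝ) * CirculantFoliation.A H S ^ n) := by
  obtain ⟨u₀⟩ : Nonempty V := hconn.nonempty.map Subtype.val
  have : Nonempty V := ⟨u₀⟩
  obtain ⟨c, hc0, hc⟩ :=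
    CirculantFoliation.exists_det_updateRow_genLaplacian hV hE hconn u₀
  obtain ⟨N, r, hr, hr1⟩ := CirculantFoliation.exists_toLaurent_eq (S := S) hc
  have hq := CirculantFoliation.q_pos hpos hgcd
  have hne {M : ℕ} {p : Polynomial ℂ}
      (hp : Polynomial.toLaurent p = LaurentPolynomial.T (M : ℤ) * CirculantFoliation.P H S)
      {z : ℂ} (hz : ‖z‖ = 1) (hz1 : z ≠ 1) : p.eval z ≠ 0 := by
    have hz0 : z ≠ 0 := norm_ne_zero_iff.1 (by rw [hz]; exact one_ne_zero)
    rw [CirculantFoliation.eval_eq_pow_mul_symbol H S hp hz0]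
    exact mul_ne_zero (pow_ne_zero _ hz0)
      (CirculantFoliation.symbol_ne_zero hV hE hconn hgcd hz hz1)
  have hA {M : ℕ} {p : Polynomial ℂ}
      (hp : Polynomial.toLaurent p = LaurentPolynomial.T (M : ℤ) * CirculantFoliation.P H S) :
      p.mahlerMeasure = CirculantFoliation.A H S := by
    refine CirculantFoliation.mahlerMeasure_eq_A hp ?_
    rintro rfl
    -- `-1` is a convenient point of the circle other than `1`, where the zero polynomial would have
    -- to be nonzero.
    exact hne hp (z := -1) (by simp) (by norm_num) (by simp)
  refine ⟨CirculantFoliation.intervalIntegrable_log_abs_eval_Q hr, fun _ _ hp => hA hp, ?_⟩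
  have hrA : r.mahlerMeasure = CirculantFoliation.A H S := by
    rw [← hA hr, Polynomial.mahlerMeasure_mul, sq, Polynomial.mahlerMeasure_mul,
      ← Polynomial.C_1, Polynomial.mahlerMeasure_X_sub_C]
    simp
  have hr0 (z : ℂ) (hz : ‖z‖ = 1) : r.eval z ≠ 0 := by
    by_cases hz1 : z = 1
    · rw [hz1, hr1, neg_ne_zero]
      exact mul_ne_zero hc0 (Nat.cast_ne_zero.2 hq.ne')
    · intro h
      exact hne hr hz hz1 (by simp [h])
  refine Asymptotics.isEquivalent_iff_exists_eq_mul.2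
    ⟨_, CirculantFoliation.tendsto_prod_norm_eval_div_mahlerMeasure r hr0, ?_⟩
  filter_upwards [Filter.eventually_gt_atTop 0] with n hn
  have : NeZero n := ⟨hn.ne'⟩
  have hA0 : CirculantFoliation.A H S ≠ 0 := (Real.exp_pos _).ne'
  rw [CirculantFoliation.numSpanningTrees_foliation_eq_prod_norm hV hE hc hr hr1 hq n,
    CirculantFoliation.prod_norm_eval_stdAddChar, Pi.mul_apply, hrA]
  field_simp
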